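/- Let $\mathbb X$ be a finite-dimensional real inner product space and let $f,g:\mathbb X\to(-\infty,\infty]$ be proper lower semicontinuous functions such that $g$ is continuous relative to its domain ${\rm dom}\,g$, the set ${\rm cl}({\rm dom}\,g)$ is convex (the function $g$ itself need not be convex), $f$ is finite and twice continuously differentiable on an open set $\mathcal O\supset{\rm cl}({\rm dom}\,g)$, and $F:=f+g$ is bounded below. For $\gamma>0$ and a self-adjoint positive definite linear map $\mathcal D:\mathbb X\to\mathbb X$, put $\phi_{\gamma,\mathcal D}:=\frac1{2\gamma}\langle\cdot,\mathcal D\,\cdot\rangle-f$ and define the generalized forward-backward envelope $F_{\gamma,\mathcal D}:=\inf_{y\in\mathbb X}G_{\gamma,\mathcal D}(\cdot,y)$, where $G_{\gamma,\mathcal D}(x,y):=F(y)+\phi_{\gamma,\mathcal D}(y)-\phi_{\gamma,\mathcal D}(x)-\langle\nabla\phi_{\gamma,\mathcal D}(x),y-x\rangle$, that is, $G_{\gamma,\mathcal D}(x,y)=f(x)+\langle\nabla f(x),y-x\rangle+\frac1{2\gamma}\langle y-x,\mathcal D(y-x)\rangle+g(y)$, if $x\in{\rm cl}({\rm dom}\,g)$,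 and $G_{\gamma,\mathcal D}(x,y):=\infty$ otherwise. A proper function $h:\mathbb X\to(-\infty,\infty]$ has the KL property of exponent $\theta\in[0,1)$ at $\bar x$ if $\partial h(\bar x)\neq\emptyset$ and there exist $c,\delta>0$ and $\varpi\in(0,\infty]$ such that $\varphi'(h(x)-h(\bar x))\,{\rm dist}(0,\partial h(x))\ge1$ with $\varphi(t)=c\,t^{1-\theta}$ for all $x$ with $\|x-\bar x\|\le\delta$ and $h(\bar x)<h(x)<h(\bar x)+\varpi$; here $\partial h$ is the limiting subdifferential and the distance to the empty set is $\infty$. Let $\bar x\in{\rm cl}({\rm dom}\,g)$, let $\varepsilon>0$ be such that the closed ball $\mathbb B(\bar x,\varepsilon)$ is contained in $\mathcal O$, and let $L:=\max_{x\in\mathbb B(\bar x,\varepsilon)}{\rm lip}\,\nabla f(x)$, where ${\rm lip}\,\nabla f(x):=\limsup_{u,v\to x,\,u\ne v}\|\nabla f(u)-\nabla f(v)\|/\|u-v\|$. Suppose that $g$ is prox-bounded with threshold $\lambda_g\in(0,\infty]$, i.e. the set of all $\lambda>0$ such that $\inf_z\{g(z)+\frac1{2\lambda}\|z-x\|^2\}>-\infty$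 for some $x\in\mathbb X$ is nonempty and has supremum $\lambda_g$, and that $F$ has the KL property of exponent $\theta\in[\frac12,1)$ at $\bar x$. Then, for every $\eta>0$, every linear map $\mathcal D$ such that $\mathcal D-\eta\mathcal I$ is self-adjoint and positive semidefinite, and every $\gamma$ with $0<\gamma<\min\{\eta\lambda_g,\eta/L\}$ (where $\eta/0:=\infty$), the function $F_{\gamma,\mathcal D}$ has the KL property of exponent $\theta$ at $\bar x$. -/

import Mathlib

open Filter Topology
open scoped ENNReal RealInnerProductSpace

noncomputable section

namespace FBE

variable {X : Type*} [NormedAddCommGroup X] [InnerProductSpace ℝ X]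

/-- The effective domain of an extended-real-valued function. -/
def dom (h : X → EReal) : Set X := {x | h x < ⊤}

/-- A proper function: it never takes the value `-∞` and is finite somewhere. -/
def IsProper (h : X → EReal) : Prop := (∀ x, ⊥ < h x) ∧ (dom h).Nonempty

/-- The regular (Fréchet) subdifferential of `h` at `x` (empty where `h` is not finite):
`v` belongs to it if and only if `h y ≥ h x + ⟪v, y - x⟫ - o(‖y - x‖)` as `y → x`. -/
def regularSubdiff (h : X → EReal) (x : X) : Set X :=
  {v | h x ≠ ⊥ ∧ h x ≠ ⊤ ∧ ∀ ε : ℝ, 0 < ε → ∀ᶠ y in 𝓝 x,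
    (((h x).toReal + ⟪v, y - x⟫ - ε * ‖y - x‖ : ℝ) : EReal) ≤ h y}

/-- The limiting (Mordukhovich, "general") subdifferential of `h` at `x`: limits of regular
subgradients `v k` at points `u k → x` with `h (u k) → h x`. -/
def limitingSubdiff (h : X → EReal) (x : X) : Set X :=
  {v | h x ≠ ⊥ ∧ h x ≠ ⊤ ∧ ∃ u w : ℕ → X, Tendsto u atTop (𝓝 x) ∧
    Tendsto (fun k => h (u k)) atTop (𝓝 (h x)) ∧
    (∀ k, w k ∈ regularSubdiff h (u k)) ∧ Tendsto w atTop (𝓝 v)}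

/-- The Kurdyka-Łojasiewicz inequality for `h` around `xb` with desingularizing function `φ`:
`φ'(h x - h xb) * dist (0, ∂h x) ≥ 1` for all `x` in some ball around `xb` such that
`h xb < h x < h xb + ϖ`, for some `ϖ ∈ (0, ∞]`. The distance to the empty set is `∞`. -/
def KLInequality (h : X → EReal) (xb : X) (φ : ℝ → ℝ) : Prop :=
  ∃ δ : ℝ, 0 < δ ∧ ∃ ϖ : EReal, 0 < ϖ ∧
    ∀ x ∈ Metric.closedBall xb δ, h xb < h x → h x < h xb + ϖ →
      1 ≤ ENNReal.ofReal (deriv φ ((h x).toReal - (h xb).toReal)) *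
        Metric.infEDist 0 (limitingSubdiff h x)

/-- The proper function `h` has the KL property of exponent `θ` at `xb ∈ dom ∂h`: the KL
inequality holds with `φ t = c * t ^ (1 - θ)` for some `c > 0`. -/
def HasKLExponent (h : X → EReal) (xb : X) (θ : ℝ) : Prop :=
  IsProper h ∧ (limitingSubdiff h xb).Nonempty ∧
    ∃ c : ℝ, 0 < c ∧ KLInequality h xb (fun t => c * t ^ (1 - θ))

/-- The Moreau envelope of `h` with parameter `μ`. -/
def moreauEnvelope (h : X → EReal) (μ : ℝ) (x : X) : EReal :=
  ⨅ z : X, (((1 / (2 * μ)) * ‖z - x‖ ^ 2 : ℝ) : EReal) + h z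

/-- `h` is prox-bounded: some Moreau envelope of it is not `-∞` at some point. -/
def IsProxBounded (h : X → EReal) : Prop :=
  ∃ μ : ℝ, 0 < μ ∧ ∃ x, ⊥ < moreauEnvelope h μ x

/-- The threshold of prox-boundedness: the supremum in `[0, ∞]` of all `μ > 0` such that the
Moreau envelope of `h` with parameter `μ` is not `-∞` at some point. -/
def proxThreshold (h : X → EReal) : ℝ≥0∞ :=
  sSup (ENNReal.ofReal '' {μ : ℝ | 0 < μ ∧ ∃ x, ⊥ < moreauEnvelope h μ x})

/-- The Lipschitz modulus of `T` at `x`: the upper limit of `‖T u - T v‖ / ‖u - v‖` as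
`u, v → x` with `u ≠ v`. -/
def lipModulus (T : X → X) (x : X) : ℝ≥0∞ :=
  limsup (fun p : X × X => edist (T p.1) (T p.2) / edist p.1 p.2)
    (𝓝[{p : X × X | p.1 ≠ p.2}] (x, x))

/-- The function `(1 / (2 γ)) ‖y‖_D ^ 2 - f y`, where `‖y‖_D ^ 2 = ⟪y, D y⟫`. (It is only
relevant at points where `f` is finite.) -/
def kernelFun (f : X → EReal) (D : X →ₗ[ℝ] X) (γ : ℝ) (y : X) : ℝ :=
  (1 / (2 * γ)) * ⟪y, D y⟫ - (f y).toReal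

variable [FiniteDimensional ℝ X]

/-- The Bregman difference `φ y - φ x - ⟪∇φ x, y - x⟫`. -/
def bregman (φ : X → ℝ) (y x : X) : ℝ :=
  φ y - φ x - ⟪gradient φ x, y - x⟫

open Classical in
/-- The function `G x y = F y + B y x` with `F = f + g`, where `B` is the Bregman difference
of `kernelFun f D γ` if `x` lies in the closure of `dom g`, and `∞` otherwise. -/
def fbModel (f g : X → EReal) (D : X →ₗ[ℝ] X) (γ : ℝ) (x y : X) : EReal :=
  if x ∈ closure (dom g) then
    (f y + g y) + ((bregman (kernelFun f D γ) y x : ℝ) : EReal)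
  else ⊤

/-- The generalized forward-backward envelope of `F = f + g`. -/
def fbEnvelope (f g : X → EReal) (D : X →ₗ[ℝ] X) (γ : ℝ) (x : X) : EReal :=
  ⨅ y : X, fbModel f g D γ x y

end FBE

end

noncomputable section

namespace FBE

variable {X : Type*} [NormedAddCommGroup X] [InnerProductSpace ℝ X]

/-! Write `F` for `f + g`, `φ` for the kernel, `B` for its Bregman difference, `C` for the closure
of `dom g`, and `h` for the envelope. Since `γ < η / L`, on a ball around `xb` the gradient of `φ`
is `K`-Lipschitz and `l`-strongly monotone with `l > 0`. Below the prox threshold the model is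
coercive, so `h x = F y + B y x` for some minimizer `y`. Put `d = ‖y - x‖`.

Two estimates carry the KL inequality. First, `l * d ≤ ‖v‖` for each regular subgradient `v` of `h`
at `x` (`mul_norm_sub_le_of_mem_regularSubdiff`): test `v` along the segment from `x` to `y`, which
stays in the convex set `C`, bound `h` there by the same `y`, and apply the three-point identity. No
formula for the subdifferential of `h` is needed, and `y` may be far away. Second, `(h x - h xb) ^
θ` is at most a multiple of `d` when `y` is close to `x`: `∇φ x - ∇φ y` is a subgradient of `F` at
`y` of norm at most `K * d`, so KL for `F` controls `F y - F xb`; the rest, `B y x ≤ K * d ^ 2`, is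
absorbed because `d ^ (2 * θ) ≤ d` for `θ ≥ 1/2` and `d ≤ 1`. `klInequality_bregman_envelope`
combines the two.

For a limiting subgradient of `h` at `xb`, the envelope is Lipschitz on `C` near `xb`, and quadratic
penalization produces bounded subgradients at nearby points. -/

/-! ### Subgradients and the KL inequality -/

/-- A regular subgradient is a limiting subgradient. -/
lemma regularSubdiff_subset_limitingSubdiff (h : X → EReal) (x : X) :
    regularSubdiff h x ⊆ limitingSubdiff h x := fun v hv =>
  ⟨hv.1, hv.2.1, fun _ => x, fun _ => v, tendsto_const_nhds, tendsto_const_nhds, fun _ => hv,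
    tendsto_const_nhds⟩

/-- The KL inequality of exponent `θ`, in a form free of derivatives and distances. -/
lemma KLInequality.rpow_le {h : X → EReal} {xb : X} {θ c b : ℝ} (hθ : θ < 1) (hc : 0 < c)
    (hb : h xb = b) (hKL : KLInequality h xb (fun t => c * t ^ (1 - θ))) :
    ∃ δ : ℝ, 0 < δ ∧ ∃ ϖ : ℝ, 0 < ϖ ∧ ∃ κ : ℝ, 0 < κ ∧
      ∀ x ∈ Metric.closedBall xb δ, ∀ v ∈ limitingSubdiff h x, ∀ r : ℝ, h x = r → b < r →
        r < b + ϖ → (r - b) ^ θ ≤ κ * ‖v‖ := by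
  obtain ⟨δ, hδ, ϖ, hϖ, H⟩ := hKL
  -- `ϖ` may be infinite; a smaller real width suffices.
  obtain ⟨w, hw0, hw⟩ := EReal.lt_iff_exists_real_btwn.1 hϖ
  have hw0' : 0 < w := by exact_mod_cast hw0
  refine ⟨δ, hδ, w, hw0', c * (1 - θ), mul_pos hc (by linarith), ?_⟩
  intro x hx v hv r hr hbr hrw
  have h1 : h xb < h x := by rw [hb, hr]; exact_mod_cast hbr
  have h2 : h x < h xb + ϖ := by
    have h3 : h x < h xb + (w : EReal) := by rw [hb, hr]; exact_mod_cast hrw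
    exact h3.trans_le (add_le_add le_rfl hw.le)
  have h4 := H x hx h1 h2
  have hpos : 0 < r - b := by linarith
  have hder : deriv (fun t : ℝ => c * t ^ (1 - θ)) (r - b) = c * (1 - θ) * (r - b) ^ (-θ) := by
    rw [deriv_const_mul_field, Real.deriv_rpow_const]
    ring_nf
  rw [hr, hb, EReal.toReal_coe, EReal.toReal_coe, hder] at h4
  have h5 : Metric.infEDist 0 (limitingSubdiff h x) ≤ ENNReal.ofReal ‖v‖ := by
    have := Metric.infEDist_le_edist_of_mem (x := (0 : X)) hv
    rwa [edist_dist, dist_zero_left] at this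
  have h6 : (0 : ℝ) ≤ c * (1 - θ) * (r - b) ^ (-θ) :=
    mul_nonneg (mul_pos hc (by linarith)).le (Real.rpow_nonneg hpos.le _)
  have h7 : (1 : ℝ≥0∞) ≤ ENNReal.ofReal (c * (1 - θ) * (r - b) ^ (-θ) * ‖v‖) := by
    rw [ENNReal.ofReal_mul h6]
    exact h4.trans (mul_le_mul_right h5 _)
  rw [ENNReal.one_le_ofReal, Real.rpow_neg hpos.le] at h7
  have h8 : 0 < (r - b) ^ θ := Real.rpow_pos_of_pos hpos _
  calc (r - b) ^ θ ≤ (r - b) ^ θ * (c * (1 - θ) * ((r - b) ^ θ)⁻¹ * ‖v‖) :=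
        le_mul_of_one_le_right h8.le h7
    _ = c * (1 - θ) * ‖v‖ := by field_simp

/-- To verify the KL inequality of exponent `θ` it suffices to consider regular subgradients. -/
lemma klInequality_rpow_of_regularSubdiff {h : X → EReal} {xb : X} {θ b δ ϖ κ : ℝ}
    (hθ0 : 0 ≤ θ) (hθ : θ < 1) (hb : h xb = b) (hδ : 0 < δ) (hϖ : 0 < ϖ) (hκ : 0 < κ)
    (H : ∀ x ∈ Metric.ball xb δ, ∀ v ∈ regularSubdiff h x, ∀ r : ℝ, h x = r → b < r →
      r < b + ϖ → (r - b) ^ θ ≤ κ * ‖v‖) :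
    ∃ c : ℝ, 0 < c ∧ KLInequality h xb (fun t => c * t ^ (1 - θ)) := by
  have hθ1 : 0 < 1 - θ := by linarith
  -- The factor `1 / (1 - θ)` makes the derivative `κ * t ^ (-θ)`. Halving `δ` keeps sequences
  -- converging to `x` eventually inside the open ball.
  refine ⟨κ / (1 - θ), div_pos hκ hθ1, δ / 2, by positivity, ϖ, by exact_mod_cast hϖ, ?_⟩
  intro x hx h1 h2
  have hxt : h x ≠ ⊤ := ne_top_of_lt h2
  have hxb : h x ≠ ⊥ := ne_bot_of_gt h1
  obtain ⟨r, hr⟩ : ∃ r : ℝ, h x = r := ⟨_, (EReal.coe_toReal hxt hxb).symm⟩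
  rw [hr, hb] at h1 h2
  have hbr : b < r := by exact_mod_cast h1
  have hrw : r < b + ϖ := by exact_mod_cast h2
  have hpos : 0 < r - b := by linarith
  have hder : deriv (fun t : ℝ => κ / (1 - θ) * t ^ (1 - θ)) (r - b) = κ * (r - b) ^ (-θ) := by
    rw [deriv_const_mul_field, Real.deriv_rpow_const]
    field_simp
    ring_nf
  rw [hr, hb, EReal.toReal_coe, EReal.toReal_coe, hder]
  have h8 : 0 < (r - b) ^ θ := Real.rpow_pos_of_pos hpos _
  have hinf : ENNReal.ofReal ((r - b) ^ θ / κ) ≤ Metric.infEDist 0 (limitingSubdiff h x) := by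
    rw [Metric.le_infEDist]
    rintro v ⟨-, -, u, w, hu, hhu, hw, hwv⟩
    rw [edist_dist, dist_zero_left]
    refine ENNReal.ofReal_le_ofReal ?_
    rw [div_le_iff₀' hκ]
    have hreal : Tendsto (fun k => (h (u k)).toReal) atTop (𝓝 r) := by
      have := (EReal.tendsto_toReal hxt hxb).comp hhu
      rwa [hr, EReal.toReal_coe] at this
    have hlim1 : Tendsto (fun k => ((h (u k)).toReal - b) ^ θ) atTop (𝓝 ((r - b) ^ θ)) :=
      (hreal.sub_const b).rpow_const (Or.inr hθ0)
    refine le_of_tendsto_of_tendsto hlim1 (hwv.norm.const_mul κ) ?_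
    have hball : ∀ᶠ k in atTop, u k ∈ Metric.ball xb δ := by
      refine hu.eventually (Metric.isOpen_ball.mem_nhds ?_)
      rw [Metric.mem_closedBall] at hx
      rw [Metric.mem_ball]
      linarith
    filter_upwards [hball, hreal.eventually (lt_mem_nhds hbr),
      hreal.eventually (gt_mem_nhds hrw)] with k hk1 hk2 hk3
    exact H (u k) hk1 (w k) (hw k) _ (EReal.coe_toReal (hw k).2.1 (hw k).1).symm hk2 hk3
  calc (1 : ℝ≥0∞) = ENNReal.ofReal (κ * (r - b) ^ (-θ) * ((r - b) ^ θ / κ)) := by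
        rw [Real.rpow_neg hpos.le]
        rw [show κ * ((r - b) ^ θ)⁻¹ * ((r - b) ^ θ / κ) = 1 by field_simp]
        simp
    _ = ENNReal.ofReal (κ * (r - b) ^ (-θ)) * ENNReal.ofReal ((r - b) ^ θ / κ) :=
        ENNReal.ofReal_mul (mul_nonneg hκ.le (Real.rpow_nonneg hpos.le _))
    _ ≤ _ := mul_le_mul_right hinf _

variable [FiniteDimensional ℝ X]

/-- A function that is Lipschitz on a closed set `C` near a point of `C`, and `∞` off `C`, has a
limiting subgradient at that point. -/
lemma limitingSubdiff_nonempty_of_lipschitz {h : X → EReal} {ψ : X → ℝ} {C : Set X}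
    (hC : IsClosed C) {xb : X} (hxb : xb ∈ C) {r M : ℝ} (hr : 0 < r) (hM : 0 ≤ M)
    (hin : ∀ x ∈ C ∩ Metric.closedBall xb r, h x = ψ x) (hout : ∀ x ∉ C, h x = ⊤)
    (hψ : ∀ x ∈ C ∩ Metric.closedBall xb r, ∀ y ∈ C ∩ Metric.closedBall xb r,
      ψ y ≤ ψ x + M * ‖x - y‖) :
    (limitingSubdiff h xb).Nonempty := by
  set S := C ∩ Metric.closedBall xb r with hS
  have hScomp : IsCompact S := (isCompact_closedBall xb r).inter_left hC
  have hxbS : xb ∈ S := ⟨hxb, Metric.mem_closedBall_self hr.le⟩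
  have hcont : ContinuousOn ψ S := by
    have : LipschitzOnWith M.toNNReal ψ S := by
      refine LipschitzOnWith.of_dist_le_mul fun x hx y hy => ?_
      rw [Real.coe_toNNReal _ hM, Real.dist_eq, dist_eq_norm, abs_le]
      have h1 := hψ x hx y hy
      have h2 := hψ y hy x hx
      rw [norm_sub_rev] at h2
      constructor <;> linarith
    exact this.continuousOn
  -- Penalization: minimizers of `ψ + k/2 ‖· - xb‖²` tend to `xb`, and `-k (u k - xb)` is a
  -- subgradient at `u k`, bounded by comparison with `xb`.
  have hex : ∀ k : ℕ, ∃ u ∈ S, ∀ x ∈ S,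
      ψ u + (k : ℝ) / 2 * ‖u - xb‖ ^ 2 ≤ ψ x + (k : ℝ) / 2 * ‖x - xb‖ ^ 2 := fun k =>
    hScomp.exists_isMinOn ⟨xb, hxbS⟩ (hcont.add (by fun_prop))
  choose u huS hu using hex
  have hbd : ∀ k : ℕ, (k : ℝ) * ‖u k - xb‖ ≤ 2 * M := by
    intro k
    have h1 := hu k xb hxbS
    have h2 := hψ (u k) (huS k) xb hxbS
    simp only [sub_self, norm_zero] at h1
    rcases (norm_nonneg (u k - xb)).eq_or_lt with h0 | h0
    · rw [← h0]; linarith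
    · have h3 : (k : ℝ) * ‖u k - xb‖ * ‖u k - xb‖ ≤ 2 * M * ‖u k - xb‖ := by nlinarith
      exact le_of_mul_le_mul_right h3 h0
  have hlim : Tendsto u atTop (𝓝 xb) := by
    rw [tendsto_iff_norm_sub_tendsto_zero]
    refine squeeze_zero' (Eventually.of_forall fun k => norm_nonneg _) ?_
      (tendsto_const_div_atTop_nhds_zero_nat (2 * M))
    filter_upwards [eventually_gt_atTop 0] with k hk
    rw [le_div_iff₀' (by exact_mod_cast hk)]
    exact hbd k
  obtain ⟨v, -, n, hn, hnv⟩ := tendsto_subseq_of_bounded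
    (s := Metric.closedBall (0 : X) (2 * M)) Metric.isBounded_closedBall
    (x := fun k => -((k : ℝ) • (u k - xb))) (fun k => by
      rw [mem_closedBall_zero_iff, norm_neg, norm_smul, Real.norm_natCast]; exact hbd k)
  have hball : ∀ᶠ k in atTop, u k ∈ Metric.ball xb r :=
    hlim.eventually (Metric.ball_mem_nhds xb hr)
  have hulim : Tendsto (fun k => u (n k)) atTop (𝓝 xb) := hlim.comp hn.tendsto_atTop
  -- Only from `N` on are the minimizers interior to the ball, so that minimality over `S` is local
  -- minimality over `C`.
  obtain ⟨N, hN⟩ := eventually_atTop.1 (hn.tendsto_atTop.eventually hball)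
  have hreg : ∀ k, N ≤ k → -((n k : ℝ) • (u (n k) - xb)) ∈ regularSubdiff h (u (n k)) := by
    intro k hk
    have hval := hin _ (huS (n k))
    refine ⟨by rw [hval]; exact EReal.coe_ne_bot _, by rw [hval]; exact EReal.coe_ne_top _, ?_⟩
    intro ε hε
    have hev1 : ∀ᶠ y in 𝓝 (u (n k)), y ∈ Metric.ball xb r := Metric.isOpen_ball.mem_nhds (hN k hk)
    have hev2 : ∀ᶠ y in 𝓝 (u (n k)), (n k : ℝ) / 2 * ‖y - u (n k)‖ < ε := by
      have hc : ContinuousAt (fun y => (n k : ℝ) / 2 * ‖y - u (n k)‖) (u (n k)) := by fun_prop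
      refine hc.eventually (gt_mem_nhds ?_)
      simpa using hε
    filter_upwards [hev1, hev2] with y hy1 hy2
    by_cases hyC : y ∈ C
    · have hyS : y ∈ S := ⟨hyC, Metric.ball_subset_closedBall hy1⟩
      rw [hin y hyS, hval, EReal.toReal_coe, EReal.coe_le_coe_iff]
      have h1 := hu (n k) y hyS
      have h2 : ‖y - xb‖ ^ 2 = ‖u (n k) - xb‖ ^ 2 + 2 * ⟪u (n k) - xb, y - u (n k)⟫
          + ‖y - u (n k)‖ ^ 2 := by
        rw [← norm_add_sq_real]
        congr 2
        abel
      rw [inner_neg_left, real_inner_smul_left]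
      rw [h2] at h1
      nlinarith [norm_nonneg (y - u (n k))]
    · rw [hout y hyC]; exact le_top
  have hbx := hin xb hxbS
  refine ⟨v, by rw [hbx]; exact EReal.coe_ne_bot _, by rw [hbx]; exact EReal.coe_ne_top _,
    fun k => u (n (k + N)), fun k => -((n (k + N) : ℝ) • (u (n (k + N)) - xb)),
    (tendsto_add_atTop_iff_nat N).2 hulim, ?_, fun k => hreg _ (by omega),
    (tendsto_add_atTop_iff_nat N).2 hnv⟩
  rw [hbx]
  simp_rw [hin _ (huS _)]
  refine (continuous_coe_real_ereal.tendsto _).comp ?_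
  have h1 : Tendsto (fun k => u (n k)) atTop (𝓝[S] xb) :=
    tendsto_nhdsWithin_iff.2 ⟨hulim, Eventually.of_forall fun k => huS _⟩
  exact ((hcont xb hxbS).tendsto.comp h1).comp (tendsto_add_atTop_nat N)

/-! ### Bregman differences -/

/-- Measures the effect of moving the base point while `y` stays fixed; this is how both the
subgradient bound and the Lipschitz estimate for the envelope arise. -/
lemma bregman_three_point (φ : X → ℝ) (x x' y : X) :
    bregman φ y x = bregman φ y x' + bregman φ x' x
      + ⟪gradient φ x' - gradient φ x, y - x'⟫ := by
  simp only [bregman, inner_sub_left, inner_sub_right]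
  ring

lemma bregman_self (φ : X → ℝ) (x : X) : bregman φ x x = 0 := by simp [bregman]

/-- The Bregman difference as an increment of the gradient. -/
lemma exists_bregman_eq {φ : X → ℝ} {U : Set X} (hU : Convex ℝ U)
    (hφ : ∀ u ∈ U, DifferentiableAt ℝ φ u) {x y : X} (hx : x ∈ U) (hy : y ∈ U) :
    ∃ s : ℝ, 0 ≤ s ∧ s ≤ 1 ∧ x + s • (y - x) ∈ U ∧
      bregman φ y x = ⟪gradient φ (x + s • (y - x)) - gradient φ x, y - x⟫ := by
  obtain ⟨z, hz, h⟩ := domain_mvt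
    (fun u hu => ((hφ u hu).hasGradientAt.hasFDerivAt).hasFDerivWithinAt) hU hx hy
  rw [segment_eq_image'] at hz
  obtain ⟨s, ⟨hs0, hs1⟩, rfl⟩ := hz
  refine ⟨s, hs0, hs1, hU.add_smul_sub_mem hx hy ⟨hs0, hs1⟩, ?_⟩
  rw [bregman, h, inner_sub_left]
  simp

lemma bregman_nonneg {φ : X → ℝ} {U : Set X} (hU : Convex ℝ U)
    (hφ : ∀ u ∈ U, DifferentiableAt ℝ φ u)
    (hmono : ∀ u ∈ U, ∀ v ∈ U, 0 ≤ ⟪gradient φ u - gradient φ v, u - v⟫)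
    {x y : X} (hx : x ∈ U) (hy : y ∈ U) : 0 ≤ bregman φ y x := by
  obtain ⟨s, hs0, hs1, hz, h⟩ := exists_bregman_eq hU hφ hx hy
  rw [h]
  rcases hs0.eq_or_lt with rfl | hs
  · simp
  · have := hmono _ hz _ hx
    rw [add_sub_cancel_left, real_inner_smul_right] at this
    exact nonneg_of_mul_nonneg_right this hs

/-- The mean value theorem gives `K` rather than the sharp `K / 2`, which is enough here. -/
lemma bregman_le {φ : X → ℝ} {U : Set X} (hU : Convex ℝ U)
    (hφ : ∀ u ∈ U, DifferentiableAt ℝ φ u) {K : ℝ} (hK : 0 ≤ K)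
    (hlip : ∀ u ∈ U, ∀ v ∈ U, ‖gradient φ u - gradient φ v‖ ≤ K * ‖u - v‖)
    {x y : X} (hx : x ∈ U) (hy : y ∈ U) : bregman φ y x ≤ K * ‖y - x‖ ^ 2 := by
  obtain ⟨s, hs0, hs1, hz, h⟩ := exists_bregman_eq hU hφ hx hy
  rw [h]
  have h1 := hlip _ hz _ hx
  rw [add_sub_cancel_left, norm_smul, Real.norm_of_nonneg hs0] at h1
  have h2 : K * (s * ‖y - x‖) ≤ K * ‖y - x‖ :=
    mul_le_mul_of_nonneg_left (mul_le_of_le_one_left (norm_nonneg _) hs1) hK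
  calc _ ≤ _ := real_inner_le_norm _ _
    _ ≤ K * ‖y - x‖ * ‖y - x‖ := mul_le_mul_of_nonneg_right (h1.trans h2) (norm_nonneg _)
    _ = _ := by ring

/-! ### Subgradients and KL inequality of a Bregman envelope -/

/-- The optimality condition for a minimizer of `F + bregman φ · x`. -/
lemma gradient_sub_mem_regularSubdiff {F : X → EReal} {φ : X → ℝ} {x y : X}
    (hφ : DifferentiableAt ℝ φ y) (hbot : F y ≠ ⊥) (htop : F y ≠ ⊤)
    (hmin : ∀ z, F y + (bregman φ y x : EReal) ≤ F z + (bregman φ z x : EReal)) :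
    gradient φ x - gradient φ y ∈ regularSubdiff F y := by
  refine ⟨hbot, htop, fun ε hε => ?_⟩
  obtain ⟨c, hc⟩ : ∃ c : ℝ, F y = c := ⟨_, (EReal.coe_toReal htop hbot).symm⟩
  have ho := (hasFDerivAt_iff_isLittleO.1 hφ.hasGradientAt.hasFDerivAt).def hε
  filter_upwards [ho] with z hz
  have h1 := hmin z
  rw [hc] at h1 ⊢
  rw [EReal.toReal_coe]
  induction hFz : F z with
  | bot =>
    rw [hFz, EReal.bot_add, ← EReal.coe_add] at h1
    exact absurd (le_bot_iff.1 h1) (EReal.coe_ne_bot _)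
  | top => exact le_top
  | coe d =>
    rw [hFz] at h1
    norm_cast at h1 ⊢
    rw [Real.norm_eq_abs, InnerProductSpace.toDual_apply_apply] at hz
    have h2 := (abs_le.1 hz).2
    simp only [bregman, inner_sub_left, inner_sub_right] at h1 h2 ⊢
    linarith

/-- Regular subgradients of a Bregman envelope at `x` are bounded below by the distance from `x`
to the minimizers. -/
lemma mul_norm_sub_le_of_mem_regularSubdiff {F h : X → EReal} {φ : X → ℝ} {C U : Set X}
    (hC : Convex ℝ C) (hU : Convex ℝ U) {x y v : X} (hxU : U ∈ 𝓝 x)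
    (hφ : ∀ u ∈ U, DifferentiableAt ℝ φ u) {l : ℝ} (hl : 0 ≤ l)
    (hmono : ∀ u ∈ U, ∀ v ∈ U, l * ‖u - v‖ ^ 2 ≤ ⟪gradient φ u - gradient φ v, u - v⟫)
    (hx : x ∈ C) (hy : y ∈ C) {c : ℝ} (hF : F y = c)
    (hle : ∀ x' ∈ C, h x' ≤ F y + (bregman φ y x' : EReal))
    (heq : h x = F y + (bregman φ y x : EReal)) (hv : v ∈ regularSubdiff h x) :
    l * ‖y - x‖ ≤ ‖v‖ := by
  suffices hs : l * ‖y - x‖ ^ 2 ≤ -⟪v, y - x⟫ by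
    have h1 : -⟪v, y - x⟫ ≤ ‖v‖ * ‖y - x‖ :=
      (neg_le_abs _).trans (abs_real_inner_le_norm _ _)
    rcases (norm_nonneg (y - x)).eq_or_lt with h0 | h0
    · rw [← h0]; simp
    · refine le_of_mul_le_mul_right ?_ h0
      linarith [sq (‖y - x‖), mul_assoc l ‖y - x‖ ‖y - x‖]
  have hpath : Tendsto (fun t : ℝ => x + t • (y - x)) (𝓝[>] 0) (𝓝 x) := by
    have : ContinuousAt (fun t : ℝ => x + t • (y - x)) 0 := by fun_prop
    have h2 := this.tendsto
    simp only [zero_smul, add_zero] at h2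
    exact h2.mono_left nhdsWithin_le_nhds
  -- Apply the subgradient inequality at `x + t (y - x)`, divide by `t`, and let `t` decrease to
  -- `0`; then let `ε` do so.
  have key : ∀ ε : ℝ, 0 < ε → l * ‖y - x‖ ^ 2 + ⟪v, y - x⟫ ≤ ε * ‖y - x‖ := by
    intro ε hε
    have hlim : Tendsto (fun t : ℝ => l * (1 - t) * ‖y - x‖ ^ 2 + ⟪v, y - x⟫) (𝓝[>] 0)
        (𝓝 (l * ‖y - x‖ ^ 2 + ⟪v, y - x⟫)) := by
      have : ContinuousAt (fun t : ℝ => l * (1 - t) * ‖y - x‖ ^ 2 + ⟪v, y - x⟫) 0 := by fun_prop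
      have h2 := this.tendsto
      simp only [sub_zero, mul_one] at h2
      exact h2.mono_left nhdsWithin_le_nhds
    refine le_of_tendsto hlim ?_
    have hone : ∀ᶠ t : ℝ in 𝓝[>] 0, t < 1 :=
      nhdsWithin_le_nhds (gt_mem_nhds one_pos)
    filter_upwards [hpath.eventually (hv.2.2 ε hε), hpath.eventually hxU, hone,
      self_mem_nhdsWithin] with t ht1 htU htlt htpos
    have ht0 : 0 < t := htpos
    set x' := x + t • (y - x) with hx'
    have hx'C : x' ∈ C := hC.add_smul_sub_mem hx hy ⟨ht0.le, htlt.le⟩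
    have h3 := ht1.trans (hle x' hx'C)
    rw [heq, hF, ← EReal.coe_add, ← EReal.coe_add, EReal.toReal_coe, EReal.coe_le_coe_iff] at h3
    have hxx : x' - x = t • (y - x) := by rw [hx', add_sub_cancel_left]
    have hyx : y - x' = (1 - t) • (y - x) := by rw [hx']; module
    have h4 := bregman_nonneg hU hφ
      (fun u hu w hw => (mul_nonneg hl (sq_nonneg _)).trans (hmono u hu w hw))
      (mem_of_mem_nhds hxU) htU
    have h5 := hmono x' htU x (mem_of_mem_nhds hxU)
    have h6 := bregman_three_point φ x x' y
    rw [hxx, norm_smul, Real.norm_of_nonneg ht0.le, real_inner_smul_right] at h5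
    rw [hyx, real_inner_smul_right] at h6
    rw [hxx, norm_smul, Real.norm_of_nonneg ht0.le, real_inner_smul_right] at h3
    set q := ⟪gradient φ x' - gradient φ x, y - x⟫
    have h7 : l * t * ‖y - x‖ ^ 2 ≤ q := by
      refine le_of_mul_le_mul_left ?_ ht0
      calc t * (l * t * ‖y - x‖ ^ 2) = l * (t * ‖y - x‖) ^ 2 := by ring
        _ ≤ _ := h5
    have h8 : (1 - t) * (l * t * ‖y - x‖ ^ 2) ≤ (1 - t) * q :=
      mul_le_mul_of_nonneg_left h7 (by linarith)
    refine le_of_mul_le_mul_left ?_ ht0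
    linarith [h8, h3, h6, h4]
  have hlim : Tendsto (fun ε : ℝ => ε * ‖y - x‖) (𝓝[>] 0) (𝓝 0) := by
    have : ContinuousAt (fun ε : ℝ => ε * ‖y - x‖) 0 := by fun_prop
    have h2 := this.tendsto
    simp only [zero_mul] at h2
    exact h2.mono_left nhdsWithin_le_nhds
  have := ge_of_tendsto hlim (eventually_nhdsWithin_of_forall fun ε hε => key ε hε)
  linarith

/-- A Bregman envelope whose minimizers stay bounded has a limiting subgradient. -/
lemma limitingSubdiff_nonempty_of_bregman {F h : X → EReal} {φ : X → ℝ} {C : Set X}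
    (hC : IsClosed C) {xb : X} (hxb : xb ∈ C) {r K R : ℝ} (hr : 0 < r) (hK : 0 ≤ K) (hR : 0 ≤ R)
    (hφ : ∀ u ∈ Metric.ball xb r, DifferentiableAt ℝ φ u)
    (hlip : ∀ u ∈ Metric.ball xb r, ∀ v ∈ Metric.ball xb r,
      ‖gradient φ u - gradient φ v‖ ≤ K * ‖u - v‖)
    (hout : ∀ x ∉ C, h x = ⊤)
    (hle : ∀ x ∈ C, ∀ y, h x ≤ F y + (bregman φ y x : EReal))
    (hatt : ∀ x ∈ C ∩ Metric.ball xb r, ∃ y ∈ C, ∃ c : ℝ, F y = c ∧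
      h x = F y + (bregman φ y x : EReal) ∧ ‖y - x‖ ≤ R) :
    (limitingSubdiff h xb).Nonempty := by
  have hsub : C ∩ Metric.closedBall xb (r / 2) ⊆ C ∩ Metric.ball xb r :=
    Set.inter_subset_inter_right _ (Metric.closedBall_subset_ball (by linarith))
  have hreal : ∀ x ∈ C ∩ Metric.closedBall xb (r / 2), h x = ((h x).toReal : EReal) := by
    intro x hx
    obtain ⟨y, -, c, hc, hh, -⟩ := hatt x (hsub hx)
    rw [hh, hc, ← EReal.coe_add, EReal.toReal_coe]
  -- In `M`, `K * r` bounds the quadratic term, as points of the half ball are within `r` of each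
  -- other, and `K * R` bounds the cross term.
  refine limitingSubdiff_nonempty_of_lipschitz (ψ := fun x => (h x).toReal) (r := r / 2)
    (M := K * (r + R)) hC hxb (by positivity) (by positivity) hreal hout ?_
  intro x hx x' hx'
  have hxU := (hsub hx).2
  have hxU' := (hsub hx').2
  obtain ⟨y, -, c, hc, hh, hyR⟩ := hatt x (hsub hx)
  have h1 := hle x' hx'.1 y
  rw [hreal x' hx', hc] at h1
  rw [hc, hreal x hx] at hh
  norm_cast at h1 hh
  have h2 := bregman_three_point φ x' x y
  have h3 := bregman_le (convex_ball xb r) hφ hK hlip hxU' hxU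
  have h4 : ⟪gradient φ x - gradient φ x', y - x⟫ ≤ K * ‖x - x'‖ * R :=
    (real_inner_le_norm _ _).trans
      (mul_le_mul (hlip x hxU x' hxU') hyR (norm_nonneg _) (by positivity))
  have h5 : ‖x - x'‖ ≤ r := by
    have e1 := Metric.mem_closedBall.1 hx.2
    have e2 := Metric.mem_closedBall.1 hx'.2
    have := dist_triangle_right x x' xb
    rw [← dist_eq_norm]
    linarith
  have h6 : K * ‖x - x'‖ ^ 2 ≤ K * ‖x - x'‖ * r := by
    rw [sq, ← mul_assoc]
    exact mul_le_mul_of_nonneg_left h5 (by positivity)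
  have h7 : K * (r + R) * ‖x - x'‖ = K * ‖x - x'‖ * r + K * ‖x - x'‖ * R := by ring
  linarith

/-- The KL inequality with exponent in `[1/2, 1)` passes from `F` to its Bregman envelope. -/
lemma klInequality_bregman_envelope {F h : X → EReal} {φ : X → ℝ} {C : Set X}
    (hC : Convex ℝ C) {xb : X} (hxb : xb ∈ C) {r K l : ℝ} (hr : 0 < r) (hK : 0 ≤ K) (hl : 0 < l)
    (hφ : ∀ u ∈ Metric.ball xb r, DifferentiableAt ℝ φ u)
    (hlip : ∀ u ∈ Metric.ball xb r, ∀ v ∈ Metric.ball xb r,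
      ‖gradient φ u - gradient φ v‖ ≤ K * ‖u - v‖)
    (hmono : ∀ u ∈ Metric.ball xb r, ∀ v ∈ Metric.ball xb r,
      l * ‖u - v‖ ^ 2 ≤ ⟪gradient φ u - gradient φ v, u - v⟫)
    (hout : ∀ x ∉ C, h x = ⊤)
    (hle : ∀ x ∈ C, ∀ y, h x ≤ F y + (bregman φ y x : EReal))
    (hatt : ∀ x ∈ C ∩ Metric.ball xb r, ∃ y ∈ C, ∃ c : ℝ, F y = c ∧
      h x = F y + (bregman φ y x : EReal))
    {b : ℝ} (hb : F xb = b) (hlsc : LowerSemicontinuousAt F xb)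
    {θ : ℝ} (hθ : θ ∈ Set.Ico (1 / 2 : ℝ) 1)
    (hKL : ∃ c : ℝ, 0 < c ∧ KLInequality F xb (fun t => c * t ^ (1 - θ))) :
    ∃ c : ℝ, 0 < c ∧ KLInequality h xb (fun t => c * t ^ (1 - θ)) := by
  have hθ0 : (0 : ℝ) < θ := by linarith [hθ.1]
  obtain ⟨e, he⟩ : ∃ e : ℝ, h xb = e := by
    obtain ⟨y, -, c, hc, hh⟩ := hatt xb ⟨hxb, Metric.mem_ball_self hr⟩
    exact ⟨_, by rw [hh, hc, ← EReal.coe_add]⟩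
  have heb : e ≤ b := by
    have := hle xb hxb xb
    rw [he, hb, bregman_self] at this
    norm_cast at this
    simpa using this
  have hB0 : ∀ {x y : X}, x ∈ Metric.ball xb r → y ∈ Metric.ball xb r → 0 ≤ bregman φ y x :=
    fun hx hy => bregman_nonneg (convex_ball xb r) hφ
      (fun u hu w hw => (mul_nonneg hl.le (sq_nonneg _)).trans (hmono u hu w hw)) hx hy
  have hBK : ∀ {x y : X}, x ∈ Metric.ball xb r → y ∈ Metric.ball xb r →
      bregman φ y x ≤ K * ‖y - x‖ ^ 2 :=
    fun hx hy => bregman_le (convex_ball xb r) hφ hK hlip hx hy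
  have hnear : ∃ ρ : ℝ, 0 < ρ ∧ ρ ≤ r ∧ ∃ ϖ : ℝ, 0 < ϖ ∧ ∃ κ : ℝ, 0 < κ ∧
      ∀ x ∈ Metric.ball xb ρ, x ∈ C → ∀ y ∈ Metric.ball x ρ, ∀ c s : ℝ, F y = c → h x = s →
        h x = F y + (bregman φ y x : EReal) → e < s → s < e + ϖ →
        (s - e) ^ θ ≤ κ * ‖y - x‖ := by
    have htwo : ∀ {ρ : ℝ} {x y : X}, x ∈ Metric.ball xb ρ → y ∈ Metric.ball x ρ →
        dist y xb < 2 * ρ := by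
      intro ρ x y hx hy
      rw [Metric.mem_ball] at hx hy
      linarith [dist_triangle y x xb]
    -- If `h xb < F xb`, the claim is vacuous: by semicontinuity and `B ≥ 0`, nearby minimizers
    -- force `s > (e + b) / 2`, beyond the chosen width.
    rcases heb.lt_or_eq with hlt | rfl
    · have hev : ∀ᶠ y in 𝓝 xb, (((e + b) / 2 : ℝ) : EReal) < F y :=
        hlsc _ <| show (((e + b) / 2 : ℝ) : EReal) < F xb by
          rw [hb, EReal.coe_lt_coe_iff]; linarith
      obtain ⟨ρ, hρ, hball⟩ := Metric.eventually_nhds_iff.1 hev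
      refine ⟨min (ρ / 2) (r / 2), by positivity, (min_le_right _ _).trans (by linarith),
        (b - e) / 2, by linarith, 1, one_pos, ?_⟩
      intro x hx hxC y hy c s hc hs hh h1 h2
      have hd := htwo hx hy
      have hm1 := min_le_left (ρ / 2) (r / 2)
      have hm2 := min_le_right (ρ / 2) (r / 2)
      have h3 := hball (y := y) (by linarith)
      have h4 := hB0 (x := x) (y := y)
        (Metric.mem_ball.2 ((Metric.mem_ball.1 hx).trans_le (by linarith)))
        (Metric.mem_ball.2 (by linarith))
      rw [hs, hc] at hh
      rw [hc] at h3
      norm_cast at hh h3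
      linarith
    · obtain ⟨c₀, hc₀, hKL⟩ := hKL
      obtain ⟨δ, hδ, ϖ, hϖ, κ, hκ, H⟩ := hKL.rpow_le hθ.2 hc₀ hb
      set ρ := min (min (δ / 2) (r / 2)) 1 with hρdef
      have hρ : 0 < ρ := by positivity
      have hρ1 : ρ ≤ 1 := min_le_right _ _
      have hρδ : ρ ≤ δ / 2 := (min_le_left _ _).trans (min_le_left _ _)
      have hρr : ρ ≤ r / 2 := (min_le_left _ _).trans (min_le_right _ _)
      -- The summand `1` only secures positivity, since `K` may vanish.
      refine ⟨ρ, hρ, by linarith, ϖ, hϖ, κ * K + K ^ θ + 1, by positivity, ?_⟩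
      intro x hx hxC y hy c s hc hs hh h1 h2
      have hd := htwo hx hy
      have hxU : x ∈ Metric.ball xb r :=
        Metric.mem_ball.2 ((Metric.mem_ball.1 hx).trans_le (by linarith))
      have hyU : y ∈ Metric.ball xb r := Metric.mem_ball.2 (by linarith)
      have hmin : ∀ z, F y + (bregman φ y x : EReal) ≤ F z + (bregman φ z x : EReal) :=
        fun z => hh ▸ hle x hxC z
      have hsub := regularSubdiff_subset_limitingSubdiff _ _ <|
        gradient_sub_mem_regularSubdiff (hφ y hyU) (by rw [hc]; exact EReal.coe_ne_bot _)
          (by rw [hc]; exact EReal.coe_ne_top _) hmin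
      have hs' : s = c + bregman φ y x := by rw [hs, hc] at hh; exact_mod_cast hh
      have hBn := hB0 hxU hyU
      have hBl := hBK hxU hyU
      set d := ‖y - x‖ with hdd
      have hd0 : 0 ≤ d := norm_nonneg _
      have hd1 : d ≤ 1 := by
        have := Metric.mem_ball.1 hy
        rw [dist_eq_norm] at this
        linarith
      have hBθ : (K * d ^ 2) ^ θ ≤ K ^ θ * d := by
        rw [Real.mul_rpow hK (sq_nonneg _), ← Real.rpow_natCast d 2, ← Real.rpow_mul hd0]
        refine mul_le_mul_of_nonneg_left ?_ (Real.rpow_nonneg hK _)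
        calc d ^ (((2 : ℕ) : ℝ) * θ) ≤ d ^ (1 : ℝ) :=
              Real.rpow_le_rpow_of_exponent_ge_of_imp hd0 hd1
                (by push_cast; linarith [hθ.1]) (fun _ h => absurd h (by positivity))
          _ = d := Real.rpow_one d
      have hκK : 0 ≤ κ * K * d := by positivity
      -- When `F y ≤ F xb`, KL for `F` says nothing, but then `s - e` is at most the Bregman term.
      -- Otherwise `c ≤ s` keeps `c` in the KL range.
      rcases le_or_gt c e with hce | hce
      · calc (s - e) ^ θ ≤ (K * d ^ 2) ^ θ :=
              Real.rpow_le_rpow (by linarith) (by linarith) hθ0.le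
          _ ≤ K ^ θ * d := hBθ
          _ ≤ _ := by nlinarith
      · have h3 := H y (Metric.mem_closedBall.2 (by linarith)) _ hsub c hc hce (by linarith)
        have h4 : κ * ‖gradient φ x - gradient φ y‖ ≤ κ * (K * d) := by
          refine mul_le_mul_of_nonneg_left ?_ hκ.le
          rw [hdd, norm_sub_rev y x]
          exact hlip x hxU y hyU
        calc (s - e) ^ θ ≤ ((c - e) + K * d ^ 2) ^ θ :=
              Real.rpow_le_rpow (by linarith) (by linarith) hθ0.le
          _ ≤ (c - e) ^ θ + (K * d ^ 2) ^ θ :=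
              Real.rpow_add_le_add_rpow (by linarith) (by positivity) hθ0.le hθ.2.le
          _ ≤ κ * (K * d) + K ^ θ * d := add_le_add (h3.trans h4) hBθ
          _ ≤ _ := by nlinarith
  obtain ⟨ρ, hρ, hρr, ϖ, hϖ, κ, hκ, H⟩ := hnear
  -- The first summand serves minimizers within `ρ` of `x`. The second serves distant ones, where
  -- `‖v‖ ≥ l * ρ` while the left side is at most `ϖ ^ θ`.
  have hκ' : 0 < κ / l + ϖ ^ θ / (l * ρ) := by positivity
  refine klInequality_rpow_of_regularSubdiff hθ0.le hθ.2 he hρ hϖ hκ' ?_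
  intro x hx v hv s hs h1 h2
  have hxC : x ∈ C := by
    by_contra hx'
    rw [hout x hx'] at hs
    exact EReal.coe_ne_top _ hs.symm
  have hxU : x ∈ Metric.ball xb r := Metric.ball_subset_ball hρr hx
  obtain ⟨y, hyC, c, hc, hh⟩ := hatt x ⟨hxC, hxU⟩
  have hv' := mul_norm_sub_le_of_mem_regularSubdiff hC (convex_ball xb r)
    (Metric.isOpen_ball.mem_nhds hxU) hφ hl.le hmono hxC hyC hc (fun x' hx' => hle x' hx' y) hh hv
  rw [add_mul]
  rcases lt_or_ge (‖y - x‖) ρ with hlt | hge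
  · have h3 := H x hx hxC y (by rw [Metric.mem_ball, dist_eq_norm]; exact hlt) c s hc hs hh h1 h2
    have h4 : κ * ‖y - x‖ ≤ κ / l * ‖v‖ := by
      calc κ * ‖y - x‖ = κ / l * (l * ‖y - x‖) := by field_simp
        _ ≤ _ := mul_le_mul_of_nonneg_left hv' (by positivity)
    have h5 : 0 ≤ ϖ ^ θ / (l * ρ) * ‖v‖ := by positivity
    linarith
  · have h3 : (s - e) ^ θ ≤ ϖ ^ θ := Real.rpow_le_rpow (by linarith) (by linarith) hθ0.le
    have h4 : ϖ ^ θ ≤ ϖ ^ θ / (l * ρ) * ‖v‖ := by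
      calc ϖ ^ θ = ϖ ^ θ / (l * ρ) * (l * ρ) := by field_simp
        _ ≤ _ := mul_le_mul_of_nonneg_left
          ((mul_le_mul_of_nonneg_left hge hl.le).trans hv') (by positivity)
    have h5 : 0 ≤ κ / l * ‖v‖ := by positivity
    linarith

/-! ### Lipschitz modulus, prox threshold and the kernel -/

lemma exists_lipschitz_of_lipModulus_lt {Y : Type*} [NormedAddCommGroup Y]
    {T : Y → Y} {x : Y} {K : ℝ} (hK : 0 ≤ K)
    (h : lipModulus T x < ENNReal.ofReal K) :
    ∃ r : ℝ, 0 < r ∧ ∀ u ∈ Metric.ball x r, ∀ v ∈ Metric.ball x r,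
      ‖T u - T v‖ ≤ K * ‖u - v‖ := by
  have hev := eventually_lt_of_limsup_lt h
  rw [eventually_nhdsWithin_iff, Metric.eventually_nhds_iff] at hev
  obtain ⟨r, hr, H⟩ := hev
  refine ⟨r, hr, fun u hu v hv => ?_⟩
  rcases eq_or_ne u v with rfl | huv
  · simp
  have h1 := H (y := (u, v)) (by rw [Prod.dist_eq]; exact max_lt hu hv) huv
  have h2 := (ENNReal.div_le_iff (by simpa using huv) (edist_ne_top u v)).1 h1.le
  rw [edist_dist, edist_dist, ← ENNReal.ofReal_mul hK,
    ENNReal.ofReal_le_ofReal_iff (by positivity), dist_eq_norm, dist_eq_norm] at h2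
  exact h2

/-- Below `η` times the threshold, `g` is minorized by a quadratic of curvature below `η / γ`. -/
lemma exists_quadratic_minorant {Y : Type*} [NormedAddCommGroup Y] {g : Y → EReal} {η γ : ℝ}
    (hη : 0 < η)
    (h : ENNReal.ofReal γ < ENNReal.ofReal η * proxThreshold g) :
    ∃ μ : ℝ, 0 < μ ∧ γ / η < μ ∧ ∃ (z : Y) (c : ℝ), ∀ y,
      ((c - 1 / (2 * μ) * ‖y - z‖ ^ 2 : ℝ) : EReal) ≤ g y := by
  have h1 : ENNReal.ofReal (γ / η) < proxThreshold g := by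
    rw [ENNReal.ofReal_div_of_pos hη]
    exact ENNReal.div_lt_of_lt_mul' h
  obtain ⟨_, ⟨μ, ⟨hμ, z, hz⟩, rfl⟩, hlt⟩ := lt_sSup_iff.1 h1
  obtain ⟨c, -, hc⟩ := EReal.lt_iff_exists_real_btwn.1 hz
  refine ⟨μ, hμ, (ENNReal.ofReal_lt_ofReal_iff hμ).1 hlt, z, c, fun y => ?_⟩
  have h2 : (c : EReal) ≤ ((1 / (2 * μ) * ‖y - z‖ ^ 2 : ℝ) : EReal) + g y :=
    hc.le.trans (iInf_le _ y)
  induction hgy : g y with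
  | bot =>
    rw [hgy, EReal.add_bot] at h2
    exact absurd (le_bot_iff.1 h2) (EReal.coe_ne_bot _)
  | top => exact le_top
  | coe d =>
    rw [hgy] at h2
    norm_cast at h2 ⊢
    linarith

lemma hasGradientAt_kernelFun {f : X → EReal} {D : X →ₗ[ℝ] X} (hD : D.IsSymmetric) (γ : ℝ) {x : X}
    (hf : DifferentiableAt ℝ (fun u => (f u).toReal) x) :
    HasGradientAt (kernelFun f D γ) ((1 / γ) • D x - gradient (fun u => (f u).toReal) x) x := by
  have hDx : HasFDerivAt (fun y => D y) (LinearMap.toContinuousLinearMap D) x :=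
    (LinearMap.toContinuousLinearMap D).hasFDerivAt
  have h1 := (((hasFDerivAt_id x).inner ℝ hDx).const_mul (1 / (2 * γ))).sub
    hf.hasGradientAt.hasFDerivAt
  rw [hasGradientAt_iff_hasFDerivAt]
  refine h1.congr_fderiv ?_
  ext v
  have h2 : ⟪x, D v⟫ = ⟪D x, v⟫ := (hD x v).symm
  have h3 : ⟪v, D x⟫ = ⟪D x, v⟫ := real_inner_comm _ _
  simp [h2, h3]
  ring

lemma bregman_kernelFun {f : X → EReal} {D : X →ₗ[ℝ] X} (hD : D.IsSymmetric) (γ : ℝ) {x : X}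
    (hf : DifferentiableAt ℝ (fun u => (f u).toReal) x) (y : X) :
    bregman (kernelFun f D γ) y x = 1 / (2 * γ) * ⟪y - x, D (y - x)⟫ - ((f y).toReal
      - (f x).toReal - ⟪gradient (fun u => (f u).toReal) x, y - x⟫) := by
  have h2 : ⟪x, D y⟫ = ⟪D x, y⟫ := (hD x y).symm
  have h3 : ⟪y, D x⟫ = ⟪D x, y⟫ := real_inner_comm _ _
  have h4 : ⟪x, D x⟫ = ⟪D x, x⟫ := real_inner_comm _ _
  rw [bregman, (hasGradientAt_kernelFun hD γ hf).gradient]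
  simp only [kernelFun, map_sub, inner_sub_left, inner_sub_right, real_inner_smul_left, h2, h3, h4]
  ring

/-- The `f y` in `F` cancels the one in the kernel, leaving `g` plus a continuous function of `y`.
Off `dom g` both sides are infinite, so `f y` need not be finite there. -/
lemma fbModel_eq {f g : X → EReal} (hf : ∀ x, ⊥ < f x) (hg : ∀ x, ⊥ < g x)
    (hfin : ∀ x ∈ dom g, f x < ⊤) {D : X →ₗ[ℝ] X} (hD : D.IsSymmetric) (γ : ℝ) {x : X}
    (hx : x ∈ closure (dom g)) (hfx : DifferentiableAt ℝ (fun u => (f u).toReal) x) (y : X) :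
    fbModel f g D γ x y = g y + (((f x).toReal + ⟪gradient (fun u => (f u).toReal) x, y - x⟫
      + 1 / (2 * γ) * ⟪y - x, D (y - x)⟫ : ℝ) : EReal) := by
  rw [fbModel, if_pos hx, bregman_kernelFun hD γ hfx]
  by_cases hy : g y < ⊤
  · obtain ⟨c, hc⟩ : ∃ c : ℝ, g y = c := ⟨_, (EReal.coe_toReal hy.ne (hg y).ne').symm⟩
    obtain ⟨d, hd⟩ : ∃ d : ℝ, f y = d :=
      ⟨_, (EReal.coe_toReal (hfin y hy).ne (hf y).ne').symm⟩
    rw [hc, hd, EReal.toReal_coe]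
    norm_cast
    ring
  · rw [not_lt_top_iff.1 hy, EReal.add_top_of_ne_bot (hf y).ne',
      EReal.top_add_coe, EReal.top_add_coe]

/-! ### Coercivity and attainment -/

/-- The model `fbModel f g D γ x ·` is coercive, uniformly for `x` in a compact set. -/
lemma exists_coercive_fbModel {f g : X → EReal} (hf : ∀ x, ⊥ < f x) (hg : ∀ x, ⊥ < g x) {O : Set X}
    (hO : IsOpen O) (hgO : closure (dom g) ⊆ O) (hf_fin : ∀ x ∈ O, f x < ⊤)
    (hf_diff : ContDiffOn ℝ 1 (fun x => (f x).toReal) O)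
    {D : X →ₗ[ℝ] X} {η γ : ℝ} (hη : 0 < η) (hγ : 0 < γ) (hD : D.IsSymmetric)
    (hDη : ∀ u, η * ‖u‖ ^ 2 ≤ ⟪u, D u⟫)
    (hγ_prox : ENNReal.ofReal γ < ENNReal.ofReal η * proxThreshold g)
    {S : Set X} (hS : IsCompact S) (hSC : S ⊆ closure (dom g)) :
    ∃ a : ℝ, 0 < a ∧ ∃ b : ℝ, ∀ x ∈ S, ∀ y,
      ((a * ‖y - x‖ ^ 2 - b : ℝ) : EReal) ≤ fbModel f g D γ x y := by
  obtain ⟨μ, hμ, hγμ, z, c, hc⟩ := exists_quadratic_minorant hη hγ_prox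
  set fR : X → ℝ := fun u => (f u).toReal with hfR
  have hdiff : ∀ x ∈ O, DifferentiableAt ℝ fR x := fun x hx =>
    (hf_diff.contDiffAt (hO.mem_nhds hx)).differentiableAt (by norm_num)
  have hSO : S ⊆ O := hSC.trans hgO
  have hcont : ContinuousOn fR S := hf_diff.continuousOn.mono hSO
  have hgrad : ContinuousOn (gradient fR) S := by
    have h1 := (hf_diff.continuousOn_fderiv_of_isOpen hO le_rfl).mono hSO
    exact (InnerProductSpace.toDual ℝ X).symm.continuous.comp_continuousOn h1
  obtain ⟨m₀, hm₀⟩ := hS.exists_bound_of_continuousOn hcont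
  obtain ⟨m₁, hm₁⟩ := hS.exists_bound_of_continuousOn hgrad
  obtain ⟨p, hp⟩ := hS.exists_bound_of_continuousOn (f := fun x => x - z) (by fun_prop)
  have hAB : 1 / (2 * μ) < η / (2 * γ) := by
    rw [div_lt_iff₀ hη] at hγμ
    rw [div_lt_div_iff₀ (by positivity) (by positivity)]
    linarith
  set A := η / (2 * γ) with hA
  set B := 1 / (2 * μ) with hB
  have hB0 : 0 < B := by positivity
  -- Half of the curvature surplus `A - B` absorbs the linear term `(m₁ + 2 * B * p) * ‖y - x‖` by
  -- completing the square.
  refine ⟨(A - B) / 2, by linarith, m₀ - c + B * p ^ 2 + (m₁ + 2 * B * p) ^ 2 / (2 * (A - B)),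
    fun x hx y => ?_⟩
  rw [fbModel_eq hf hg (fun x hx => hf_fin x (hgO (subset_closure hx))) hD γ (hSC hx)
    (hdiff x (hSO hx))]
  refine le_trans ?_ (add_le_add (hc y) le_rfl)
  norm_cast
  have h1 : -m₀ ≤ fR x := by
    have := hm₀ x hx
    rw [Real.norm_eq_abs] at this
    exact (abs_le.1 this).1
  have h2 : -(m₁ * ‖y - x‖) ≤ ⟪gradient fR x, y - x⟫ := by
    have := (abs_le.1 (abs_real_inner_le_norm (gradient fR x) (y - x))).1
    have h3 := mul_le_mul_of_nonneg_right (hm₁ x hx) (norm_nonneg (y - x))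
    linarith
  have h3 : A * ‖y - x‖ ^ 2 ≤ 1 / (2 * γ) * ⟪y - x, D (y - x)⟫ := by
    calc A * ‖y - x‖ ^ 2 = 1 / (2 * γ) * (η * ‖y - x‖ ^ 2) := by rw [hA]; ring
      _ ≤ _ := mul_le_mul_of_nonneg_left (hDη _) (by positivity)
  have h4 : B * ‖y - z‖ ^ 2 ≤ B * (‖y - x‖ + p) ^ 2 := by
    refine mul_le_mul_of_nonneg_left (pow_le_pow_left₀ (norm_nonneg _) ?_ 2) hB0.le
    have := norm_add_le (y - x) (x - z)
    rw [sub_add_sub_cancel] at this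
    linarith [hp x hx]
  have h5 : 0 < A - B := by linarith
  have h6 : (m₁ + 2 * B * p) * ‖y - x‖
      ≤ (A - B) / 2 * ‖y - x‖ ^ 2 + (m₁ + 2 * B * p) ^ 2 / (2 * (A - B)) := by
    have h7 : 0 ≤ (A - B) / 2 * (‖y - x‖ - (m₁ + 2 * B * p) / (A - B)) ^ 2 := by positivity
    have h8 : (A - B) / 2 * (‖y - x‖ - (m₁ + 2 * B * p) / (A - B)) ^ 2
        = (A - B) / 2 * ‖y - x‖ ^ 2 + (m₁ + 2 * B * p) ^ 2 / (2 * (A - B))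
          - (m₁ + 2 * B * p) * ‖y - x‖ := by
      field_simp
      ring
    linarith
  nlinarith

/-- A coercive lower semicontinuous function, finite somewhere, attains its infimum. -/
lemma exists_eq_iInf_of_coercive {G : X → EReal} (hG : LowerSemicontinuous G) {x y₀ : X} {a b : ℝ}
    (ha : 0 < a) (hcoer : ∀ y, ((a * ‖y - x‖ ^ 2 - b : ℝ) : EReal) ≤ G y) (hy₀ : G y₀ < ⊤) :
    ∃ y, G y = ⨅ z, G z := by
  obtain ⟨m, hm, -⟩ := EReal.lt_iff_exists_real_btwn.1 hy₀
  -- The `1` ensures `‖y - x‖ ≤ ‖y - x‖ ^ 2` outside the ball.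
  set R := 1 + |(m + b) / a| with hR
  have hout : ∀ y, y ∉ Metric.closedBall x R → G y₀ < G y := by
    intro y hy
    rw [Metric.mem_closedBall, dist_eq_norm, not_le] at hy
    refine (hm.trans_le ?_).trans_le (hcoer y)
    norm_cast
    have h1 : |(m + b) / a| ≤ ‖y - x‖ ^ 2 := by nlinarith [abs_nonneg ((m + b) / a)]
    have h2 := (le_abs_self _).trans h1
    rw [div_le_iff₀ ha] at h2
    linarith
  have hmem : y₀ ∈ Metric.closedBall x R := by
    by_contra h
    exact lt_irrefl _ (hout y₀ h)
  obtain ⟨y, -, hy⟩ := LowerSemicontinuousOn.exists_isMinOn ⟨y₀, hmem⟩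
    (isCompact_closedBall x R) (hG.lowerSemicontinuousOn _)
  refine ⟨y, le_antisymm (le_iInf fun z => ?_) (iInf_le _ y)⟩
  by_cases hz : z ∈ Metric.closedBall x R
  · exact hy hz
  · exact (hy hmem).trans (hout z hz).le

end FBE

end

/-! ### The forward-backward envelope -/

theorem proposition1 {X : Type*} [NormedAddCommGroup X] [InnerProductSpace ℝ X]
    [FiniteDimensional ℝ X] (f g : X → EReal) (O : Set X)
    -- `g` is proper, lsc and continuous relative to its domain; it need not be convex
    (hg_proper : FBE.IsProper g) (hg_lsc : LowerSemicontinuous g)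
    (hg_cont : ContinuousOn g (FBE.dom g))
    (hg_dom : Convex ℝ (closure (FBE.dom g)))
    -- `f` is proper, lsc and (finite and) twice continuously differentiable on `O`
    (hf_proper : FBE.IsProper f) (hf_lsc : LowerSemicontinuous f)
    (hO : IsOpen O) (hgO : closure (FBE.dom g) ⊆ O)
    (hf_fin : ∀ x ∈ O, f x < ⊤) (hf_diff : ContDiffOn ℝ 2 (fun x => (f x).toReal) O)
    -- `F = f + g` is bounded below
    (hF_bdd : ∃ m : ℝ, ∀ x, (m : EReal) ≤ f x + g x)
    (xb : X) (hxb : xb ∈ closure (FBE.dom g))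
    (ε : ℝ) (hε : 0 < ε) (hball : Metric.closedBall xb ε ⊆ O)
    (hprox : FBE.IsProxBounded g)
    (θ : ℝ) (hθ : θ ∈ Set.Ico (1 / 2 : ℝ) 1)
    (hKL : FBE.HasKLExponent (fun x => f x + g x) xb θ)
    (D : X →ₗ[ℝ] X) (η : ℝ) (hη : 0 < η)
    (hD : (D - η • (LinearMap.id : X →ₗ[ℝ] X)).IsPositive)
    (γ : ℝ) (hγ : 0 < γ)
    (hγ_prox : ENNReal.ofReal γ < ENNReal.ofReal η * FBE.proxThreshold g)
    (hγ_lip : ENNReal.ofReal γ < ENNReal.ofReal η /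
      (⨆ x ∈ Metric.closedBall xb ε,
        FBE.lipModulus (gradient (fun u => (f u).toReal)) x)) :
    FBE.HasKLExponent (FBE.fbEnvelope f g D γ) xb θ := by
  open FBE in
  have hf := hf_proper.1
  have hg := hg_proper.1
  set C := closure (dom g) with hC
  have hgC : dom g ⊆ C := subset_closure
  have hfC : ∀ x ∈ C, f x < ⊤ := fun x hx => hf_fin x (hgO hx)
  have hdiff : ∀ x ∈ O, DifferentiableAt ℝ (fun u => (f u).toReal) x := fun x hx =>
    (hf_diff.contDiffAt (hO.mem_nhds hx)).differentiableAt (by norm_num)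
  have hsymm : D.IsSymmetric := by
    intro x y
    have := hD.1 x y
    simp only [LinearMap.sub_apply, LinearMap.smul_apply, LinearMap.id_apply, inner_sub_left,
      inner_sub_right, real_inner_smul_left, real_inner_smul_right] at this
    linarith
  have hDη : ∀ u, η * ‖u‖ ^ 2 ≤ ⟪u, D u⟫ := by
    intro u
    have := hD.2 u
    simp only [LinearMap.sub_apply, LinearMap.smul_apply, LinearMap.id_apply, inner_sub_left,
      real_inner_smul_left, real_inner_self_eq_norm_sq, RCLike.re_to_real] at this
    rw [real_inner_comm]
    linarith
  have hlipxb : lipModulus (gradient (fun u => (f u).toReal)) xb < ENNReal.ofReal (η / γ) := by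
    have h1 : lipModulus (gradient (fun u => (f u).toReal)) xb ≤ ⨆ x ∈ Metric.closedBall xb ε,
        lipModulus (gradient (fun u => (f u).toReal)) x :=
      le_iSup₂ (f := fun x (_ : x ∈ Metric.closedBall xb ε) =>
        lipModulus (gradient (fun u => (f u).toReal)) x) xb (Metric.mem_closedBall_self hε.le)
    have h2 := hγ_lip.trans_le (ENNReal.div_le_div_left h1 _)
    rw [ENNReal.lt_div_iff_mul_lt (Or.inr ENNReal.ofReal_ne_top)
      (Or.inr (ENNReal.ofReal_pos.2 hγ).ne')] at h2
    rw [ENNReal.ofReal_div_of_pos hγ, ENNReal.lt_div_iff_mul_lt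
      (Or.inl (ENNReal.ofReal_pos.2 hγ).ne') (Or.inl ENNReal.ofReal_ne_top), mul_comm]
    exact h2
  -- This `L` lies strictly between the Lipschitz modulus at `xb` and `η / γ`: the gradient of `f`
  -- is `L`-Lipschitz near `xb`, and `l = η / γ - L` is positive.
  obtain ⟨L, hL0, hL1, hL2⟩ := ENNReal.lt_iff_exists_real_btwn.1 hlipxb
  rw [ENNReal.ofReal_lt_ofReal_iff (by positivity)] at hL2
  obtain ⟨r₀, hr₀, hLip⟩ := exists_lipschitz_of_lipModulus_lt hL0 hL1
  set r := min r₀ ε with hr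
  have hr0 : 0 < r := lt_min hr₀ hε
  have hrO : Metric.ball xb r ⊆ O :=
    ((Metric.ball_subset_ball (min_le_right _ _)).trans Metric.ball_subset_closedBall).trans hball
  have hrr₀ : Metric.ball xb r ⊆ Metric.ball xb r₀ := Metric.ball_subset_ball (min_le_left _ _)
  set φ := kernelFun f D γ with hφdef
  have hφgrad : ∀ u ∈ O, HasGradientAt φ
      ((1 / γ) • D u - gradient (fun u => (f u).toReal) u) u :=
    fun u hu => hasGradientAt_kernelFun hsymm γ (hdiff u hu)
  have hφ : ∀ u ∈ Metric.ball xb r, DifferentiableAt ℝ φ u :=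
    fun u hu => (hφgrad u (hrO hu)).differentiableAt
  have hφsub : ∀ u ∈ Metric.ball xb r, ∀ v ∈ Metric.ball xb r, gradient φ u - gradient φ v
      = (1 / γ) • D (u - v) - (gradient (fun u => (f u).toReal) u
        - gradient (fun u => (f u).toReal) v) := by
    intro u hu v hv
    rw [(hφgrad u (hrO hu)).gradient, (hφgrad v (hrO hv)).gradient, map_sub]
    module
  set N := ‖LinearMap.toContinuousLinearMap D‖ with hN
  set K := 1 / γ * N + L with hKdef
  have hK : 0 ≤ K := by positivity
  have hlip : ∀ u ∈ Metric.ball xb r, ∀ v ∈ Metric.ball xb r,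
      ‖gradient φ u - gradient φ v‖ ≤ K * ‖u - v‖ := by
    intro u hu v hv
    rw [hφsub u hu v hv]
    have h1 : ‖D (u - v)‖ ≤ N * ‖u - v‖ := (LinearMap.toContinuousLinearMap D).le_opNorm (u - v)
    have h2 := hLip u (hrr₀ hu) v (hrr₀ hv)
    calc _ ≤ _ := norm_sub_le _ _
      _ ≤ 1 / γ * (N * ‖u - v‖) + L * ‖u - v‖ := by
        rw [norm_smul, Real.norm_of_nonneg (by positivity)]
        gcongr
      _ = _ := by rw [hKdef]; ring
  have hl : 0 < η / γ - L := by linarith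
  have hmono : ∀ u ∈ Metric.ball xb r, ∀ v ∈ Metric.ball xb r,
      (η / γ - L) * ‖u - v‖ ^ 2 ≤ ⟪gradient φ u - gradient φ v, u - v⟫ := by
    intro u hu v hv
    rw [hφsub u hu v hv, inner_sub_left, real_inner_smul_left, real_inner_comm]
    have h1 : η / γ * ‖u - v‖ ^ 2 ≤ 1 / γ * ⟪u - v, D (u - v)⟫ := by
      calc η / γ * ‖u - v‖ ^ 2 = 1 / γ * (η * ‖u - v‖ ^ 2) := by ring
        _ ≤ _ := mul_le_mul_of_nonneg_left (hDη _) (by positivity)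
    have h2 := real_inner_le_norm (gradient (fun u => (f u).toReal) u
        - gradient (fun u => (f u).toReal) v) (u - v)
    have h3 := mul_le_mul_of_nonneg_right (hLip u (hrr₀ hu) v (hrr₀ hv)) (norm_nonneg (u - v))
    linarith [mul_assoc L ‖u - v‖ ‖u - v‖, sq ‖u - v‖]
  obtain ⟨hFproper, ⟨v₀, hv₀⟩, hFKL⟩ := hKL
  obtain ⟨b, hb⟩ : ∃ b : ℝ, f xb + g xb = b := ⟨_, (EReal.coe_toReal hv₀.2.1 hv₀.1).symm⟩
  have hmodel : ∀ x ∈ C, ∀ y, fbModel f g D γ x y = f y + g y + (bregman φ y x : EReal) :=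
    fun x hx y => by rw [fbModel, if_pos hx]
  have hout : ∀ x ∉ C, fbEnvelope f g D γ x = ⊤ :=
    fun x hx => iInf_eq_top.2 fun y => if_neg hx
  have hle : ∀ x ∈ C, ∀ y, fbEnvelope f g D γ x ≤ f y + g y + (bregman φ y x : EReal) :=
    fun x hx y => (iInf_le _ y).trans_eq (hmodel x hx y)
  have hcoer : ∀ {S : Set X}, IsCompact S → S ⊆ C → ∃ a : ℝ, 0 < a ∧ ∃ c : ℝ, ∀ x ∈ S, ∀ y,
      ((a * ‖y - x‖ ^ 2 - c : ℝ) : EReal) ≤ fbModel f g D γ x y := fun hS hSC =>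
    exists_coercive_fbModel hf hg hO hgO hf_fin (hf_diff.of_le (by norm_num)) hη hγ hsymm hDη
      hγ_prox hS hSC
  have hatt : ∀ x ∈ C, ∃ y ∈ C, ∃ c : ℝ, f y + g y = c ∧
      fbEnvelope f g D γ x = f y + g y + (bregman φ y x : EReal) := by
    intro x hx
    obtain ⟨a, ha, c, hac⟩ := hcoer isCompact_singleton (Set.singleton_subset_iff.2 hx)
    have hGlsc : LowerSemicontinuous (fbModel f g D γ x) := by
      rw [funext (fbModel_eq hf hg (fun x hx => hfC x (hgC hx)) hsymm γ hx (hdiff x (hgO hx)))]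
      refine LowerSemicontinuous.add' hg_lsc (Continuous.lowerSemicontinuous ?_) fun y =>
        EReal.continuousAt_add (Or.inr (EReal.coe_ne_bot _)) (Or.inr (EReal.coe_ne_top _))
      have hDc : Continuous fun y => D y := D.continuous_of_finiteDimensional
      exact continuous_coe_real_ereal.comp (by fun_prop)
    have hGxb : fbModel f g D γ x xb < ⊤ := by
      rw [hmodel x hx, hb, ← EReal.coe_add]
      exact EReal.coe_lt_top _
    obtain ⟨y, hy⟩ := exists_eq_iInf_of_coercive hGlsc ha (hac x rfl) hGxb
    have hytop : f y + g y + (bregman φ y x : EReal) < ⊤ := by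
      rw [← hmodel x hx, hy]
      exact (iInf_le _ xb).trans_lt hGxb
    have hgy : g y < ⊤ := by
      by_contra h
      rw [not_lt_top_iff.1 h, EReal.add_top_of_ne_bot (hf y).ne', EReal.top_add_coe] at hytop
      exact lt_irrefl _ hytop
    have hyC : y ∈ C := hgC hgy
    refine ⟨y, hyC, (f y).toReal + (g y).toReal, ?_, hy.symm.trans (hmodel x hx y)⟩
    rw [EReal.coe_add, EReal.coe_toReal (hfC y hyC).ne (hf y).ne',
      EReal.coe_toReal hgy.ne (hg y).ne']
  have hattR : ∃ R : ℝ, 0 ≤ R ∧ ∀ x ∈ C ∩ Metric.ball xb r, ∃ y ∈ C, ∃ c : ℝ, f y + g y = c ∧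
      fbEnvelope f g D γ x = f y + g y + (bregman φ y x : EReal) ∧ ‖y - x‖ ≤ R := by
    obtain ⟨a, ha, m, hac⟩ := hcoer (S := C ∩ Metric.closedBall xb r)
      ((isCompact_closedBall xb r).inter_left isClosed_closure) Set.inter_subset_left
    -- Coercivity at `y` against the competitor `xb`: `a * ‖y - x‖ ^ 2 - m ≤ h x ≤ b + K * r ^ 2`.
    refine ⟨1 + |(b + K * r ^ 2 + m) / a|, by positivity, fun x hx => ?_⟩
    obtain ⟨y, hyC, c, hc, hh⟩ := hatt x hx.1
    refine ⟨y, hyC, c, hc, hh, ?_⟩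
    have h1 := hac x ⟨hx.1, Metric.ball_subset_closedBall hx.2⟩ y
    have h2 := hle x hx.1 xb
    rw [hmodel x hx.1, ← hh] at h1
    have h3 := h1.trans h2
    rw [hb] at h3
    norm_cast at h3
    have h4 := bregman_le (convex_ball xb r) hφ hK hlip hx.2 (Metric.mem_ball_self hr0)
    have h5 : K * ‖xb - x‖ ^ 2 ≤ K * r ^ 2 := by
      have := Metric.mem_ball'.1 hx.2
      rw [dist_eq_norm] at this
      gcongr
    have h6 : ‖y - x‖ ^ 2 ≤ (b + K * r ^ 2 + m) / a := by
      rw [le_div_iff₀ ha]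
      linarith
    nlinarith [le_abs_self ((b + K * r ^ 2 + m) / a), sq_nonneg (‖y - x‖ - 1)]
  have hFlsc : LowerSemicontinuousAt (fun x => f x + g x) xb :=
    (LowerSemicontinuous.add' hf_lsc hg_lsc fun x =>
      EReal.continuousAt_add (Or.inr (hg x).ne') (Or.inl (hf x).ne')) xb
  refine ⟨⟨fun x => ?_, xb, ?_⟩, ?_, ?_⟩
  · by_cases hx : x ∈ C
    · obtain ⟨y, -, c, hc, hh⟩ := hatt x hx
      rw [hh, hc, ← EReal.coe_add]
      exact EReal.bot_lt_coe _
    · rw [hout x hx]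
      exact bot_lt_top
  · refine (hle xb hxb xb).trans_lt ?_
    rw [hb, ← EReal.coe_add]
    exact EReal.coe_lt_top _
  · obtain ⟨R, hR, hattR⟩ := hattR
    exact limitingSubdiff_nonempty_of_bregman (F := fun x => f x + g x) isClosed_closure hxb hr0
      hK hR hφ hlip hout hle hattR
  · exact klInequality_bregman_envelope (F := fun x => f x + g x) hg_dom hxb hr0 hK hl hφ hlip
      hmono hout hle (fun x hx => hatt x hx.1) hb hFlsc hθ hFKL
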